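/- Let $\nabla$ be the torsion-free connection on $\mathbb{R}^2$ (coordinates $x^1,x^2$) whose Christoffel symbols $\Gamma_{ij}{}^k=\Gamma_{ji}{}^k\in\mathbb{R}$ are constant (a Type $\mathcal{A}$ surface). Write $R(X,Y)=\nabla_X\nabla_Y-\nabla_Y\nabla_X-\nabla_{[X,Y]}$ for its curvature operator, $\rho(X,Y)=\operatorname{Tr}\{Z\mapsto R(Z,X)Y\}$ for its Ricci tensor, $\rho_s$ for the symmetrization of $\rho$, and $\mathcal{H}_\nabla f=(\partial_{x^i}\partial_{x^j}f-\Gamma_{ij}{}^k\partial_{x^k}f)\,dx^i\otimes dx^j$ for the Hessian. For $\mu\in\mathbb{R}$ let $E(\mu,\nabla)$ be the real vector space of all $f\in C^\infty(\mathbb{R}^2)$ with $\mathcal{H}_\nabla f=\mu f\rho_s$. Two such connections are called linearly equivalent if an element of $GL(2,\mathbb{R})$, acting on $\mathbb{R}^2$, carries one to the other. Suppose that $\nabla$ is not flat. Then: 1. Either $E(0,\nabla)=\operatorname{Span}\{1\}$, or $\nabla$ is linearly equivalent to a connection $\tilde\nabla$ with constant Christoffel symbols $\tilde\Gamma_{ij}{}^k$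 for which one of the following holds: - (a) $\tilde\Gamma_{11}{}^1=1$, $\tilde\Gamma_{12}{}^1=\tilde\Gamma_{22}{}^1=0$, and $E(0,\tilde\nabla)=\operatorname{Span}\{1,e^{x^1}\}$; - (b) $\tilde\Gamma_{11}{}^1=\tilde\Gamma_{12}{}^1=\tilde\Gamma_{22}{}^1=0$, and $E(0,\tilde\nabla)=\operatorname{Span}\{1,x^1\}$. 2. $\dim E(-1,\nabla)=3$. 3. Let $\mu\in\mathbb{R}$ with $\mu\notin\{0,-1\}$. Then $\dim E(\mu,\nabla)=2$ if $\operatorname{rank}\rho=1$, and $\dim E(\mu,\nabla)=0$ if $\operatorname{rank}\rho=2$. -/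

import Mathlib

open scoped ContDiff

noncomputable section

/-- The plane `ℝ²`; the coordinates `x¹, x²` of a point `x` are `x 0, x 1`. -/
abbrev Plane : Type := Fin 2 → ℝ

/-- The partial derivative `∂f/∂xⁱ`. -/
def partialD (i : Fin 2) (f : Plane → ℝ) (x : Plane) : ℝ :=
  fderiv ℝ f x (Pi.single i 1)

/-- The coordinate vector field `∂_{xⁱ}`. -/
def coordField (i : Fin 2) : Plane → Plane := fun _ => Pi.single i 1

/-- A smooth torsion-free connection on (the tangent bundle of) the plane, given by its Christoffel
symbols: `christoffel i j k` is the function `Γ_{ij}^k`. -/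
structure AffineConnection where
  christoffel : Fin 2 → Fin 2 → Fin 2 → Plane → ℝ
  smooth : ∀ i j k, ContDiff ℝ ∞ (christoffel i j k)
  symm : ∀ i j k, christoffel i j k = christoffel j i k

namespace AffineConnection

/-- The covariant derivative `∇_X Y` of vector fields,
`(∇_X Y)^k = X^i ∂_i Y^k + Γ_{ij}^k X^i Y^j`. -/
def cov (D : AffineConnection) (X Y : Plane → Plane) : Plane → Plane := fun x k =>
  (∑ i, X x i * partialD i (fun y => Y y k) x)
    + ∑ i, ∑ j, D.christoffel i j k x * X x i * Y x j

/-- The curvature operator `R(X,Y)Z = ∇_X ∇_Y Z - ∇_Y ∇_X Z - ∇_{[X,Y]} Z`. -/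
def curvature (D : AffineConnection) (X Y Z : Plane → Plane) : Plane → Plane :=
  D.cov X (D.cov Y Z) - D.cov Y (D.cov X Z) - D.cov (VectorField.lieBracket ℝ X Y) Z

/-- The components `R_{ijk}^l` of the curvature tensor, where
`R(∂_i,∂_j)∂_k = R_{ijk}^l ∂_l`. -/
def curvatureTensor (D : AffineConnection) (i j k l : Fin 2) (x : Plane) : ℝ :=
  D.curvature (coordField i) (coordField j) (coordField k) x l

/-- The connection is flat: its curvature tensor vanishes identically. -/
def IsFlat (D : AffineConnection) : Prop :=
  ∀ i j k l x, D.curvatureTensor i j k l x = 0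

/-- The Ricci tensor `ρ(X,Y) = Tr (Z ↦ R(Z,X)Y)` at a point, as the matrix of
its components `ρ_{ij} = ρ(∂_i,∂_j)`. -/
def ricci (D : AffineConnection) (x : Plane) : Matrix (Fin 2) (Fin 2) ℝ :=
  Matrix.of fun i j => ∑ k, D.curvatureTensor k i j k x

/-- The symmetrized Ricci tensor `ρ_s`. -/
def ricciSymm (D : AffineConnection) (x : Plane) : Matrix (Fin 2) (Fin 2) ℝ :=
  (1 / 2 : ℝ) • (D.ricci x + (D.ricci x).transpose)

/-- The Hessian `(∂_i ∂_j f - Γ_{ij}^k ∂_k f) dxⁱ ⊗ dxʲ` of a function at a point. -/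
def hessian (D : AffineConnection) (f : Plane → ℝ) (x : Plane) : Matrix (Fin 2) (Fin 2) ℝ :=
  Matrix.of fun i j =>
    partialD i (partialD j f) x - ∑ k, D.christoffel i j k x * partialD k f x

theorem differentiable_partialD {f : Plane → ℝ} (hf : ContDiff ℝ ∞ f) (i : Fin 2) :
    Differentiable ℝ (partialD i f) := by
  have h : ContDiff ℝ 1 (fderiv ℝ f) := hf.fderiv_right (by norm_cast)
  exact (h.clm_apply contDiff_const).differentiable one_ne_zero

theorem hessian_add (D : AffineConnection) {f g : Plane → ℝ} (hf : ContDiff ℝ ∞ f)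
    (hg : ContDiff ℝ ∞ g) (x : Plane) : D.hessian (f + g) x = D.hessian f x + D.hessian g x := by
  have hadd : ∀ i, partialD i (f + g) = partialD i f + partialD i g := by
    intro i
    funext y
    simp [partialD, fderiv_add (hf.differentiable (by simp) y) (hg.differentiable (by simp) y)]
  ext i j
  have h2 : partialD i (partialD j f + partialD j g) x
      = partialD i (partialD j f) x + partialD i (partialD j g) x := by
    simp only [partialD.eq_def i]
    rw [fderiv_add (differentiable_partialD hf j x) (differentiable_partialD hg j x)]
    simp
  simp only [hessian, Matrix.of_apply, Matrix.add_apply, hadd, h2, Pi.add_apply,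
    Fin.sum_univ_two]
  ring

theorem hessian_smul (D : AffineConnection) (c : ℝ) {f : Plane → ℝ} (hf : ContDiff ℝ ∞ f)
    (x : Plane) : D.hessian (c • f) x = c • D.hessian f x := by
  have hsm : ∀ i, partialD i (c • f) = c • partialD i f := by
    intro i
    funext y
    simp [partialD, fderiv_const_smul (hf.differentiable (by simp) y)]
  ext i j
  have h2 : partialD i (c • partialD j f) x = c * partialD i (partialD j f) x := by
    simp only [partialD.eq_def i]
    rw [fderiv_const_smul (differentiable_partialD hf j x)]
    simp
  simp only [hessian, Matrix.of_apply, Matrix.smul_apply, hsm, h2, Pi.smul_apply,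
    Fin.sum_univ_two, smul_eq_mul]
  ring

/-- `E(μ,∇)`: the real vector space of all smooth functions `f` on the plane that satisfy the
affine quasi-Einstein equation `Hess f = μ f ρ_s`. -/
def quasiEinstein (D : AffineConnection) (μ : ℝ) : Submodule ℝ (Plane → ℝ) where
  carrier := {f | ContDiff ℝ ∞ f ∧ ∀ x, D.hessian f x = (μ * f x) • D.ricciSymm x}
  zero_mem' := by
    refine ⟨contDiff_const, fun x => ?_⟩
    have h := D.hessian_smul 0 (f := 0) contDiff_const x
    simpa using h
  add_mem' := by
    rintro f g ⟨hf, hf'⟩ ⟨hg, hg'⟩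
    refine ⟨hf.add hg, fun x => ?_⟩
    rw [D.hessian_add hf hg, hf', hg', ← add_smul, Pi.add_apply, mul_add]
  smul_mem' := by
    rintro c f ⟨hf, hf'⟩
    refine ⟨contDiff_const.smul hf, fun x => ?_⟩
    rw [D.hessian_smul c hf, hf', smul_smul, Pi.smul_apply, smul_eq_mul]
    congr 1
    ring

/-- A Type A surface `(ℝ², ∇)`: the Christoffel symbols are constant. -/
def IsTypeA (D : AffineConnection) : Prop :=
  ∃ Γ : Fin 2 → Fin 2 → Fin 2 → ℝ, ∀ i j k x, D.christoffel i j k x = Γ i j k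

/-- `D` and `D'` are linearly equivalent: an element `T` of the general linear group intertwines
them, that is `T_*(∇_X Y) = ∇'_{T_* X} (T_* Y)` for all smooth vector fields `X`, `Y`, where
`T_* X = T ∘ X ∘ T⁻¹`. -/
def LinearlyEquivalent (D D' : AffineConnection) : Prop :=
  ∃ T : Plane ≃ₗ[ℝ] Plane, ∀ X Y : Plane → Plane, ContDiff ℝ ∞ X → ContDiff ℝ ∞ Y →
    (T ∘ D.cov X Y ∘ T.symm) = D'.cov (T ∘ X ∘ T.symm) (T ∘ Y ∘ T.symm)

end AffineConnection

end

/-!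
Write `f ∈ E(μ, ∇)` as `∂ᵢ∂ⱼf = Γ_{ij}^k ∂ₖf + μ f ρ_{ij}`. The one-jet `u = (f, ∂₀f, ∂₁f)` then
satisfies a linear system `∂ᵢu = Mᵢ u` with constant matrices `M₀`, `M₁`, so `f` is determined by its
one-jet at the origin (`eq_zero_of_jet_eq_zero`), and `E(μ, ∇)` is as large as the integrability
conditions permit.

For constant Christoffel symbols the Ricci tensor is symmetric, determines the curvature
(`curvature_eq_ricci`), and satisfies the Codazzi equation (`ricciSymbols_codazzi`). Hence equating
the mixed third derivatives of `f` leaves only `(1 + μ) (ρ₁ⱼ ∂₀f - ρ₀ⱼ ∂₁f) = 0`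
(`integrability`).

* At `μ = -1` there is no condition: `M₀` and `M₁` commute, every one-jet extends to the solution
  `exp(x⁰ M₀) exp(x¹ M₁) u₀` (`exists_joint_flow`), and the dimension is three.
* If `μ ≠ -1` and `ρ` is nondegenerate, then `df = 0`. So `f` is constant, and zero unless `μ = 0`.
* If `μ ≠ -1` and `ρ = ε v ⊗ v` has rank one, then `df` is proportional to `v`, and the Codazzi
  equation gives `Γ_{ij}^k vₖ = c vᵢ vⱼ` (`exists_symbols_eq_of_ricci_rank_one`). So `f = h(v·x)` with
  `h'' = c h' + μ ε h`, a two-dimensional space. For `μ = 0` the coordinate `x⁰ = c v·x`, or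
  `x⁰ = v·x` if `c = 0`, turns this into `h'' = h'`, or `h'' = 0`.
-/

open scoped ContDiff

noncomputable section

/-! ### Partial derivatives in the plane -/

theorem contDiff_partialD {f : Plane → ℝ} (hf : ContDiff ℝ ∞ f) (i : Fin 2) :
    ContDiff ℝ ∞ (partialD i f) := by
  have h : ContDiff ℝ ∞ (fderiv ℝ f) := hf.fderiv_right (by norm_cast)
  exact h.clm_apply contDiff_const

theorem partialD_add {f g : Plane → ℝ} (hf : Differentiable ℝ f) (hg : Differentiable ℝ g)
    (i : Fin 2) : partialD i (fun x => f x + g x) = fun x => partialD i f x + partialD i g x := by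
  funext x
  simp [partialD, fderiv_fun_add (hf x) (hg x)]

theorem partialD_const_mul {f : Plane → ℝ} (hf : Differentiable ℝ f) (c : ℝ) (i : Fin 2) :
    partialD i (fun x => c * f x) = fun x => c * partialD i f x := by
  funext x
  simp [partialD, fderiv_const_mul (hf x)]

theorem partialD_const (c : ℝ) (i : Fin 2) : partialD i (fun _ => c) = fun _ => 0 := by
  funext x
  simp [partialD]

theorem partialD_comm {f : Plane → ℝ} (hf : ContDiff ℝ ∞ f) (i j : Fin 2) (x : Plane) :
    partialD i (partialD j f) x = partialD j (partialD i f) x := by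
  have hd : DifferentiableAt ℝ (fderiv ℝ f) x :=
    ((hf.fderiv_right (m := 1) (by norm_cast)).differentiable one_ne_zero) x
  have key : ∀ i j, partialD i (partialD j f) x
      = fderiv ℝ (fderiv ℝ f) x (Pi.single i 1) (Pi.single j 1) := by
    intro i j
    have : HasFDerivAt (partialD j f) _ x :=
      hd.hasFDerivAt.clm_apply (hasFDerivAt_const (Pi.single j (1 : ℝ) : Plane) x)
    simp [partialD.eq_def i, this.fderiv]
  rw [key, key]
  have hs : IsSymmSndFDerivAt ℝ f x := hf.contDiffAt.isSymmSndFDerivAt (by simp; norm_cast)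
  exact hs _ _

theorem plane_eq_smul_single (y : Plane) :
    y = y 0 • Pi.single 0 (1 : ℝ) + y 1 • Pi.single 1 (1 : ℝ) := by
  ext k; fin_cases k <;> simp

theorem fderiv_eq_partialD (f : Plane → ℝ) (x y : Plane) :
    fderiv ℝ f x y = y 0 * partialD 0 f x + y 1 * partialD 1 f x := by
  conv_lhs => rw [plane_eq_smul_single y]
  rw [map_add, map_smul, map_smul]
  rfl

/-! ### Linear first-order systems with constant coefficients -/

/-- A commuting pair of matrices generates a joint flow: the overdetermined system
`∂ᵢu = Mᵢ u` is solved by `u(x) = exp(x⁰ M₀) exp(x¹ M₁) u₀`. -/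
theorem exists_joint_flow {n : ℕ} (M : Fin 2 → Matrix (Fin n) (Fin n) ℝ)
    (h : Commute (M 0) (M 1)) (u₀ : Fin n → ℝ) :
    ∃ u : Fin n → Plane → ℝ, (∀ k, ContDiff ℝ ∞ (u k)) ∧ (∀ k, u k 0 = u₀ k) ∧
      ∀ i k x, partialD i (u k) x = ∑ l, M i k l * u l x := by
  let Φ : Matrix (Fin n) (Fin n) ℝ →ₐ[ℝ] ((Fin n → ℝ) →L[ℝ] (Fin n → ℝ)) :=
    (Module.End.toContinuousLinearMap (Fin n → ℝ)).toAlgHom.comp Matrix.toLinAlgEquiv'.toAlgHom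
  have hΦ : ∀ A v, Φ A v = A.mulVec v := fun A v => rfl
  set A := Φ (M 0) with hA
  set B := Φ (M 1) with hB
  have hAB : Commute A B := h.map Φ
  let w : Plane → (Fin n → ℝ) := fun x =>
    (NormedSpace.exp (x 0 • A)) ((NormedSpace.exp (x 1 • B)) u₀)
  have hexp : ContDiff ℝ ∞ (NormedSpace.exp : ((Fin n → ℝ) →L[ℝ] (Fin n → ℝ)) → _) :=
    contDiff_iff_contDiffAt.2 fun y => (NormedSpace.exp_analytic (𝕂 := ℝ) y).contDiffAt
  have hwsmooth : ContDiff ℝ ∞ w := by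
    have h0 : ContDiff ℝ ∞ fun x : Plane => NormedSpace.exp (x 0 • A) :=
      hexp.comp ((contDiff_apply ℝ ℝ 0).smul contDiff_const)
    have h1 : ContDiff ℝ ∞ fun x : Plane => NormedSpace.exp (x 1 • B) :=
      hexp.comp ((contDiff_apply ℝ ℝ 1).smul contDiff_const)
    exact h0.clm_apply (h1.clm_apply contDiff_const)
  have hderiv : ∀ x : Plane, HasFDerivAt w
      ((ContinuousLinearMap.proj 0 : Plane →L[ℝ] ℝ).smulRight (A (w x)) +
        (ContinuousLinearMap.proj 1 : Plane →L[ℝ] ℝ).smulRight (B (w x))) x := by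
    intro x
    have p0 : HasFDerivAt (fun x : Plane => x 0) (ContinuousLinearMap.proj 0 : Plane →L[ℝ] ℝ) x :=
      (ContinuousLinearMap.proj 0 : Plane →L[ℝ] ℝ).hasFDerivAt
    have p1 : HasFDerivAt (fun x : Plane => x 1) (ContinuousLinearMap.proj 1 : Plane →L[ℝ] ℝ) x :=
      (ContinuousLinearMap.proj 1 : Plane →L[ℝ] ℝ).hasFDerivAt
    have e0 := (hasDerivAt_exp_smul_const' A (x 0)).hasFDerivAt.comp x p0
    have e1 := (hasDerivAt_exp_smul_const' B (x 1)).hasFDerivAt.comp x p1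
    have := e0.clm_apply (e1.clm_apply (hasFDerivAt_const u₀ x))
    have hc : Commute (NormedSpace.exp (x 0 • A)) B := by
      exact ((hAB.symm.smul_right (x 0)).exp_right).symm
    refine this.congr_fderiv ?_
    ext1 y
    have hc' : ∀ v, NormedSpace.exp (x 0 • A) (B v) = B (NormedSpace.exp (x 0 • A) v) :=
      fun v => DFunLike.congr_fun hc.eq v
    simp only [w, add_apply, ContinuousLinearMap.smulRight_apply,
      ContinuousLinearMap.comp_apply, ContinuousLinearMap.flip_apply,
      ContinuousLinearMap.toSpanSingleton_apply, zero_apply, map_zero, zero_add,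
      smul_apply, map_smul]
    rw [add_comm, ← hc']
    rfl
  refine ⟨fun k x => w x k, fun k => contDiff_pi.1 hwsmooth k, fun k => by simp [w], ?_⟩
  intro i k x
  have := (hasFDerivAt_pi'.1 (hderiv x) k).fderiv
  rw [partialD, this]
  fin_cases i <;> simp [hA, hB, hΦ, Matrix.mulVec, dotProduct]

/-- A solution of `∂ᵢu = Mᵢ u` that vanishes at the origin vanishes: along each ray through the
origin it solves a linear ordinary differential equation. -/
theorem joint_flow_unique {n : ℕ} (M : Fin 2 → Matrix (Fin n) (Fin n) ℝ)
    (u : Fin n → Plane → ℝ) (hu : ∀ k, Differentiable ℝ (u k)) (h0 : ∀ k, u k 0 = 0)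
    (h : ∀ i k x, partialD i (u k) x = ∑ l, M i k l * u l x) (k : Fin n) (x : Plane) :
    u k x = 0 := by
  let L : (Fin n → ℝ) →L[ℝ] (Fin n → ℝ) :=
    LinearMap.toContinuousLinearMap (Matrix.toLin' (x 0 • M 0 + x 1 • M 1))
  have hray : ∀ t : ℝ, HasDerivAt (fun t : ℝ => fun k => u k (t • x))
      (L (fun k => u k (t • x))) t := by
    intro t
    rw [hasDerivAt_pi]
    intro k
    have hl : HasDerivAt (fun t : ℝ => t • x) x t := by
      simpa using (hasDerivAt_id t).smul_const x
    have := (hu k (t • x)).hasFDerivAt.comp_hasDerivAt t hl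
    rw [fderiv_eq_partialD, h, h] at this
    refine this.congr_deriv ?_
    simp [L, Matrix.mulVec, dotProduct, Finset.mul_sum]
  have := ODE_solution_unique_univ (v := fun _ => L) (s := fun _ => Set.univ) (K := ‖L‖₊)
    (t₀ := 0) (f := fun t : ℝ => fun k => u k (t • x)) (g := fun _ => 0)
    (fun t => L.lipschitz.lipschitzOnWith) (fun t => ⟨hray t, trivial⟩)
    (fun t => ⟨by simpa using hasDerivAt_const t (0 : Fin n → ℝ), trivial⟩)
    (by funext k; simp [h0])
  simpa using congrFun (congrFun this 1) k

namespace AffineConnection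

/-! ### Connections with constant Christoffel symbols -/

/-- The connection with constant Christoffel symbols `Γ i j k = Γ_{ij}^k`. -/
def ofSymbols (Γ : Fin 2 → Fin 2 → Fin 2 → ℝ) (hΓ : ∀ i j k, Γ i j k = Γ j i k) :
    AffineConnection where
  christoffel i j k _ := Γ i j k
  smooth _ _ _ := contDiff_const
  symm i j k := by rw [hΓ]

/-- The bilinear map `(a, b) ↦ Γ(a, b)` on `ℝ²` with components `Γ_{ij}^k aⁱ bʲ`. It is the
covariant derivative of the constant field `b` along the constant field `a`. -/
def symbolMap (Γ : Fin 2 → Fin 2 → Fin 2 → ℝ) : Plane →ₗ[ℝ] Plane →ₗ[ℝ] Plane :=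
  LinearMap.mk₂ ℝ (fun a b k => ∑ i, ∑ j, Γ i j k * a i * b j)
    (by intros; ext k; simp only [Fin.sum_univ_two, Pi.add_apply]; ring)
    (by intros; ext k; simp only [Fin.sum_univ_two, Pi.smul_apply, smul_eq_mul]; ring)
    (by intros; ext k; simp only [Fin.sum_univ_two, Pi.add_apply]; ring)
    (by intros; ext k; simp only [Fin.sum_univ_two, Pi.smul_apply, smul_eq_mul]; ring)

theorem symbolMap_apply (Γ : Fin 2 → Fin 2 → Fin 2 → ℝ) (a b : Plane) (k : Fin 2) :
    symbolMap Γ a b k = ∑ i, ∑ j, Γ i j k * a i * b j := rfl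

theorem symbolMap_single (Γ : Fin 2 → Fin 2 → Fin 2 → ℝ) (i j k : Fin 2) :
    symbolMap Γ (Pi.single i 1) (Pi.single j 1) k = Γ i j k := by
  simp [symbolMap_apply, Pi.single_apply]

theorem cov_ofSymbols (Γ : Fin 2 → Fin 2 → Fin 2 → ℝ) (hΓ : ∀ i j k, Γ i j k = Γ j i k)
    (X Y : Plane → Plane) (x : Plane) (hY : DifferentiableAt ℝ Y x) :
    (ofSymbols Γ hΓ).cov X Y x = fderiv ℝ Y x (X x) + symbolMap Γ (X x) (Y x) := by
  ext k
  have hk : fderiv ℝ Y x (X x) k = fderiv ℝ (fun y => Y y k) x (X x) := by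
    rw [fderiv_apply hY]; rfl
  rw [Pi.add_apply, hk, fderiv_eq_partialD, symbolMap_apply, cov, Fin.sum_univ_two]
  rfl

theorem cov_const (Γ : Fin 2 → Fin 2 → Fin 2 → ℝ) (hΓ : ∀ i j k, Γ i j k = Γ j i k)
    (a b : Plane) :
    (ofSymbols Γ hΓ).cov (fun _ => a) (fun _ => b) = fun _ => symbolMap Γ a b := by
  funext x
  rw [cov_ofSymbols _ _ _ _ _ (differentiableAt_const b)]
  simp

/-- For constant Christoffel symbols, `R(∂ᵢ,∂ⱼ)` is the commutator of the endomorphisms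
`Γ(∂ᵢ, ·)` and `Γ(∂ⱼ, ·)`. -/
theorem curvatureTensor_ofSymbols (Γ : Fin 2 → Fin 2 → Fin 2 → ℝ)
    (hΓ : ∀ i j k, Γ i j k = Γ j i k) (i j k l : Fin 2) (x : Plane) :
    (ofSymbols Γ hΓ).curvatureTensor i j k l x
      = (symbolMap Γ (Pi.single i 1) (symbolMap Γ (Pi.single j 1) (Pi.single k 1))
        - symbolMap Γ (Pi.single j 1) (symbolMap Γ (Pi.single i 1) (Pi.single k 1))) l := by
  have hb : VectorField.lieBracket ℝ (coordField i) (coordField j) = fun _ => 0 := by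
    funext y
    unfold coordField
    simp [VectorField.lieBracket]
  rw [curvatureTensor, curvature, hb]
  unfold coordField
  simp [cov_const]

theorem curvatureTensor_eq_sum (Γ : Fin 2 → Fin 2 → Fin 2 → ℝ)
    (hΓ : ∀ i j k, Γ i j k = Γ j i k) (i j k l : Fin 2) (x : Plane) :
    (ofSymbols Γ hΓ).curvatureTensor i j k l x
      = ∑ m, (Γ j k m * Γ i m l - Γ i k m * Γ j m l) := by
  rw [curvatureTensor_ofSymbols, Pi.sub_apply, symbolMap_apply, symbolMap_apply]
  simp only [symbolMap_single, Pi.single_apply, Fin.sum_univ_two]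
  fin_cases i <;> fin_cases j <;> simp <;> ring

theorem isFlat_ofSymbols_iff (Γ : Fin 2 → Fin 2 → Fin 2 → ℝ)
    (hΓ : ∀ i j k, Γ i j k = Γ j i k) :
    (ofSymbols Γ hΓ).IsFlat ↔
      ∀ a b c, symbolMap Γ a (symbolMap Γ b c) = symbolMap Γ b (symbolMap Γ a c) := by
  constructor
  · intro h a b c
    have h' : ∀ i j k, symbolMap Γ (Pi.single i 1) (symbolMap Γ (Pi.single j 1) (Pi.single k 1))
        = symbolMap Γ (Pi.single j 1) (symbolMap Γ (Pi.single i 1) (Pi.single k 1)) := by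
      intro i j k
      ext l
      have := h i j k l 0
      rw [curvatureTensor_ofSymbols, Pi.sub_apply, sub_eq_zero] at this
      exact this
    rw [plane_eq_smul_single a, plane_eq_smul_single b, plane_eq_smul_single c]
    simp only [map_add, map_smul, LinearMap.add_apply, LinearMap.smul_apply, h' 1 0]
    module
  · intro h i j k l x
    rw [curvatureTensor_ofSymbols, h, sub_self, Pi.zero_apply]

/-- The components `ρ_{ij}` of the Ricci tensor in terms of constant Christoffel symbols. -/
def ricciSymbols (Γ : Fin 2 → Fin 2 → Fin 2 → ℝ) (i j : Fin 2) : ℝ :=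
  ∑ k, ∑ m, (Γ i j m * Γ k m k - Γ k j m * Γ i m k)

theorem ricci_ofSymbols (Γ : Fin 2 → Fin 2 → Fin 2 → ℝ) (hΓ : ∀ i j k, Γ i j k = Γ j i k)
    (x : Plane) : (ofSymbols Γ hΓ).ricci x = Matrix.of (ricciSymbols Γ) := by
  ext i j
  simp [ricci, curvatureTensor_eq_sum, ricciSymbols]

theorem ricciSymbols_comm (Γ : Fin 2 → Fin 2 → Fin 2 → ℝ) (hΓ : ∀ i j k, Γ i j k = Γ j i k)
    (i j : Fin 2) : ricciSymbols Γ i j = ricciSymbols Γ j i := by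
  have h := hΓ 1 0
  fin_cases i <;> fin_cases j <;> simp [ricciSymbols, Fin.sum_univ_two, h] <;> ring

theorem ricciSymm_ofSymbols (Γ : Fin 2 → Fin 2 → Fin 2 → ℝ) (hΓ : ∀ i j k, Γ i j k = Γ j i k)
    (x : Plane) : (ofSymbols Γ hΓ).ricciSymm x = Matrix.of (ricciSymbols Γ) := by
  ext i j
  simp [ricciSymm, ricci_ofSymbols, ricciSymbols_comm Γ hΓ j i]
  ring

/-- In dimension two the Ricci tensor determines the curvature:
`R(X,Y)Z = ρ(Y,Z)X - ρ(X,Z)Y`. -/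
theorem curvature_eq_ricci (Γ : Fin 2 → Fin 2 → Fin 2 → ℝ) (hΓ : ∀ i j k, Γ i j k = Γ j i k)
    (j l : Fin 2) :
    ∑ m, (Γ 1 j m * Γ 0 m l - Γ 0 j m * Γ 1 m l)
      = ricciSymbols Γ 1 j * (if l = 0 then 1 else 0)
        - ricciSymbols Γ 0 j * (if l = 1 then 1 else 0) := by
  have h := hΓ 1 0
  fin_cases j <;> fin_cases l <;> simp [ricciSymbols, Fin.sum_univ_two, h]

/-- The Codazzi equation `∇₀ρ₁ⱼ = ∇₁ρ₀ⱼ`, which for constant Christoffel symbols is an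
algebraic identity. -/
theorem ricciSymbols_codazzi (Γ : Fin 2 → Fin 2 → Fin 2 → ℝ) (hΓ : ∀ i j k, Γ i j k = Γ j i k)
    (j : Fin 2) :
    ∑ k, Γ 1 j k * ricciSymbols Γ 0 k = ∑ k, Γ 0 j k * ricciSymbols Γ 1 k := by
  have h := hΓ 1 0
  fin_cases j <;> simp [ricciSymbols, Fin.sum_univ_two, h] <;> ring

theorem isFlat_of_ricciSymbols_eq_zero (Γ : Fin 2 → Fin 2 → Fin 2 → ℝ)
    (hΓ : ∀ i j k, Γ i j k = Γ j i k) (h : ∀ i j, ricciSymbols Γ i j = 0) :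
    (ofSymbols Γ hΓ).IsFlat := by
  intro i j k l x
  have h' := curvature_eq_ricci Γ hΓ k l
  simp only [h, zero_mul, sub_zero, Fin.sum_univ_two] at h'
  rw [curvatureTensor_eq_sum, Fin.sum_univ_two]
  fin_cases i <;> fin_cases j <;> simp <;> linarith

theorem IsTypeA.exists_eq_ofSymbols {D : AffineConnection} (hD : D.IsTypeA) :
    ∃ Γ hΓ, D = ofSymbols Γ hΓ := by
  obtain ⟨Γ, h⟩ := hD
  refine ⟨Γ, fun i j k => ?_, ?_⟩
  · rw [← h i j k 0, ← h j i k 0, D.symm]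
  · obtain ⟨c, _, _⟩ := D
    have : c = fun i j k _ => Γ i j k := by
      funext i j k x
      exact h i j k x
    subst this
    rfl

/-! ### The affine quasi-Einstein equation as a first-order system -/

theorem mem_quasiEinstein_iff (Γ : Fin 2 → Fin 2 → Fin 2 → ℝ) (hΓ : ∀ i j k, Γ i j k = Γ j i k)
    (μ : ℝ) (f : Plane → ℝ) :
    f ∈ (ofSymbols Γ hΓ).quasiEinstein μ ↔ ContDiff ℝ ∞ f ∧ ∀ i j x,
      partialD i (partialD j f) x
        = ∑ k, Γ i j k * partialD k f x + μ * f x * ricciSymbols Γ i j := by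
  refine and_congr_right fun _ => ?_
  simp only [← Matrix.ext_iff, ricciSymm_ofSymbols, hessian, Matrix.of_apply, Matrix.smul_apply,
    smul_eq_mul, sub_eq_iff_eq_add']
  exact ⟨fun h i j x => h x i j, fun h x i j => h i j x⟩

/-- The matrices of the first-order system `∂ᵢu = Mᵢ u` satisfied by the one-jet
`u = (f, ∂₀f, ∂₁f)` of a solution `f` of the quasi-Einstein equation. -/
def jetMatrix (Γ : Fin 2 → Fin 2 → Fin 2 → ℝ) (μ : ℝ) (i : Fin 2) :
    Matrix (Fin 3) (Fin 3) ℝ :=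
  !![0, if i = 0 then 1 else 0, if i = 1 then 1 else 0;
    μ * ricciSymbols Γ i 0, Γ i 0 0, Γ i 0 1;
    μ * ricciSymbols Γ i 1, Γ i 1 0, Γ i 1 1]

/-- A solution of the quasi-Einstein equation is determined by its one-jet at the origin. -/
theorem eq_zero_of_jet_eq_zero {Γ : Fin 2 → Fin 2 → Fin 2 → ℝ}
    {hΓ : ∀ i j k, Γ i j k = Γ j i k} {μ : ℝ} {f : Plane → ℝ}
    (hf : f ∈ (ofSymbols Γ hΓ).quasiEinstein μ) (h0 : f 0 = 0)
    (h1 : ∀ i, partialD i f 0 = 0) : f = 0 := by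
  rw [mem_quasiEinstein_iff] at hf
  obtain ⟨hs, he⟩ := hf
  have hd := fun i => differentiable_partialD hs i
  funext x
  refine joint_flow_unique (jetMatrix Γ μ) ![f, partialD 0 f, partialD 1 f] ?_ ?_ ?_ 0 x
  · intro k
    fin_cases k
    exacts [hs.differentiable (by simp), hd 0, hd 1]
  · intro k
    fin_cases k
    exacts [h0, h1 0, h1 1]
  · intro i k x
    fin_cases k
    · fin_cases i <;> simp [Fin.sum_univ_three, jetMatrix]
    all_goals
      simp only [Fin.sum_univ_three, jetMatrix]
      simp [he]
      ring

/-- The integrability condition of the quasi-Einstein equation, obtained from the equality of the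
mixed third derivatives of `f`; the terms of order zero cancel by the Codazzi equation. -/
theorem integrability {Γ : Fin 2 → Fin 2 → Fin 2 → ℝ} {hΓ : ∀ i j k, Γ i j k = Γ j i k} {μ : ℝ}
    {f : Plane → ℝ} (hf : f ∈ (ofSymbols Γ hΓ).quasiEinstein μ) (hμ : μ ≠ -1) (j : Fin 2)
    (x : Plane) :
    ricciSymbols Γ 1 j * partialD 0 f x = ricciSymbols Γ 0 j * partialD 1 f x := by
  rw [mem_quasiEinstein_iff] at hf
  obtain ⟨hs, he⟩ := hf
  have hd := fun i => differentiable_partialD hs i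
  have hfd : Differentiable ℝ f := hs.differentiable (by simp)
  have third : ∀ a i, partialD a (partialD i (partialD j f)) x
      = ∑ k, Γ i j k * partialD a (partialD k f) x
        + μ * ricciSymbols Γ i j * partialD a f x := by
    intro a i
    have e : partialD i (partialD j f) = fun y =>
        (Γ i j 0 * partialD 0 f y + Γ i j 1 * partialD 1 f y) + μ * ricciSymbols Γ i j * f y := by
      funext y
      rw [he, Fin.sum_univ_two]
      ring
    have hsum : Differentiable ℝ fun y => Γ i j 0 * partialD 0 f y + Γ i j 1 * partialD 1 f y :=
      ((hd 0).const_mul _).add ((hd 1).const_mul _)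
    rw [e, partialD_add hsum (hfd.const_mul _),
      partialD_add ((hd 0).const_mul _) ((hd 1).const_mul _), partialD_const_mul (hd 0),
      partialD_const_mul (hd 1), partialD_const_mul hfd, Fin.sum_univ_two]
  have hc := partialD_comm (contDiff_partialD hs j) 0 1 x
  rw [third, third] at hc
  have c0 := curvature_eq_ricci Γ hΓ j 0
  have c1 := curvature_eq_ricci Γ hΓ j 1
  have cz := ricciSymbols_codazzi Γ hΓ j
  simp only [Fin.sum_univ_two, he] at hc c0 c1 cz
  simp at c0 c1
  have hμ' : 1 + μ ≠ 0 := fun h => hμ (by linarith)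
  apply mul_left_cancel₀ hμ'
  linear_combination hc - partialD 0 f x * c0 - partialD 1 f x * c1 - μ * f x * cz

/-- At `μ = -1` the jet system is integrable without any condition on the jet. -/
theorem jetMatrix_commute (Γ : Fin 2 → Fin 2 → Fin 2 → ℝ) (hΓ : ∀ i j k, Γ i j k = Γ j i k) :
    Commute (jetMatrix Γ (-1) 0) (jetMatrix Γ (-1) 1) := by
  have h := hΓ 1 0
  ext i j
  fin_cases i <;> fin_cases j <;>
    simp [jetMatrix, Matrix.mul_apply, Fin.sum_univ_three, ricciSymbols, Fin.sum_univ_two, h] <;>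
    ring

/-- The one-jet at the origin, as a linear map on the solution space. -/
def jetMap (D : AffineConnection) (μ : ℝ) : D.quasiEinstein μ →ₗ[ℝ] (Fin 3 → ℝ) where
  toFun f := ![f.1 0, partialD 0 f.1 0, partialD 1 f.1 0]
  map_add' f g := by
    have h := partialD_add (f.2.1.differentiable (by simp)) (g.2.1.differentiable (by simp))
    have h' := fun i => congrFun (h i) 0
    ext k
    fin_cases k
    exacts [rfl, h' 0, h' 1]
  map_smul' c f := by
    have h := fun i => congrFun (partialD_const_mul (f.2.1.differentiable (by simp)) c i) 0
    ext k
    fin_cases k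
    exacts [rfl, h 0, h 1]

theorem jetMap_injective (Γ : Fin 2 → Fin 2 → Fin 2 → ℝ) (hΓ : ∀ i j k, Γ i j k = Γ j i k)
    (μ : ℝ) : Function.Injective ((ofSymbols Γ hΓ).jetMap μ) := by
  rw [injective_iff_map_eq_zero]
  intro f hf
  refine Subtype.ext (eq_zero_of_jet_eq_zero f.2 (congrFun hf 0) fun i => ?_)
  fin_cases i
  exacts [congrFun hf 1, congrFun hf 2]

theorem rank_quasiEinstein_neg_one (Γ : Fin 2 → Fin 2 → Fin 2 → ℝ)
    (hΓ : ∀ i j k, Γ i j k = Γ j i k) :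
    Module.rank ℝ ((ofSymbols Γ hΓ).quasiEinstein (-1)) = 3 := by
  have hsurj : Function.Surjective ((ofSymbols Γ hΓ).jetMap (-1)) := by
    intro w
    obtain ⟨u, hu, hu0, hd⟩ := exists_joint_flow (jetMatrix Γ (-1)) (jetMatrix_commute Γ hΓ) w
    have hj0 : partialD 0 (u 0) = u 1 := by
      funext x; rw [hd]; simp [Fin.sum_univ_three, jetMatrix]
    have hj1 : partialD 1 (u 0) = u 2 := by
      funext x; rw [hd]; simp [Fin.sum_univ_three, jetMatrix]
    have hmem : u 0 ∈ (ofSymbols Γ hΓ).quasiEinstein (-1) := by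
      rw [mem_quasiEinstein_iff]
      refine ⟨hu 0, fun i j x => ?_⟩
      rw [Fin.sum_univ_two, hj0, hj1]
      fin_cases j
      · simp only [Fin.zero_eta, hj0, hd, Fin.sum_univ_three]
        simp [jetMatrix]; ring
      · simp only [Fin.mk_one, hj1, hd, Fin.sum_univ_three]
        simp [jetMatrix]; ring
    refine ⟨⟨u 0, hmem⟩, ?_⟩
    ext k
    simp only [jetMap, LinearMap.coe_mk, AddHom.coe_mk, hj0, hj1]
    fin_cases k <;> simp [hu0]
  have e := LinearEquiv.ofBijective _ ⟨jetMap_injective Γ hΓ (-1), hsurj⟩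
  rw [e.rank_eq]
  simp

/-! ### Nondegenerate Ricci tensor -/

theorem partialD_eq_zero_of_det_ne_zero {Γ : Fin 2 → Fin 2 → Fin 2 → ℝ}
    {hΓ : ∀ i j k, Γ i j k = Γ j i k} {μ : ℝ} {f : Plane → ℝ}
    (hf : f ∈ (ofSymbols Γ hΓ).quasiEinstein μ) (hμ : μ ≠ -1)
    (hdet : (Matrix.of (ricciSymbols Γ)).det ≠ 0) (i : Fin 2) (x : Plane) :
    partialD i f x = 0 := by
  have h0 := integrability hf hμ 0 x
  have h1 := integrability hf hμ 1 x
  rw [Matrix.det_fin_two] at hdet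
  simp only [Matrix.of_apply] at hdet
  apply (mul_eq_zero.1 ?_).resolve_left hdet
  fin_cases i
  · simp only [Fin.zero_eta]; linear_combination ricciSymbols Γ 0 0 * h1 - ricciSymbols Γ 0 1 * h0
  · simp only [Fin.mk_one]; linear_combination ricciSymbols Γ 1 0 * h1 - ricciSymbols Γ 1 1 * h0

theorem quasiEinstein_eq_bot_of_det_ne_zero (Γ : Fin 2 → Fin 2 → Fin 2 → ℝ)
    (hΓ : ∀ i j k, Γ i j k = Γ j i k) {μ : ℝ} (hμ0 : μ ≠ 0) (hμ : μ ≠ -1)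
    (hdet : (Matrix.of (ricciSymbols Γ)).det ≠ 0) :
    (ofSymbols Γ hΓ).quasiEinstein μ = ⊥ := by
  rw [eq_bot_iff]
  intro f hf
  have hp := partialD_eq_zero_of_det_ne_zero hf hμ hdet
  have he := ((mem_quasiEinstein_iff Γ hΓ μ f).1 hf).2
  have hz : ∀ i j, f 0 * ricciSymbols Γ i j = 0 := by
    intro i j
    have e := he i j 0
    have hp' : partialD j f = fun _ => 0 := funext (hp j)
    simp only [hp, hp', partialD_const, mul_zero, Finset.sum_const_zero, zero_add] at e
    rw [mul_assoc] at e
    exact (mul_eq_zero.1 e.symm).resolve_left hμ0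
  refine eq_zero_of_jet_eq_zero hf ?_ fun i => hp i 0
  by_contra h
  refine hdet ?_
  have : ∀ i j, ricciSymbols Γ i j = 0 := fun i j => (mul_eq_zero.1 (hz i j)).resolve_left h
  simp [Matrix.det_fin_two, this]

theorem const_mem_quasiEinstein_zero (Γ : Fin 2 → Fin 2 → Fin 2 → ℝ)
    (hΓ : ∀ i j k, Γ i j k = Γ j i k) (c : ℝ) :
    (fun _ => c) ∈ (ofSymbols Γ hΓ).quasiEinstein 0 := by
  rw [mem_quasiEinstein_iff]
  exact ⟨contDiff_const, fun i j x => by simp [partialD_const]⟩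

theorem quasiEinstein_zero_of_det_ne_zero (Γ : Fin 2 → Fin 2 → Fin 2 → ℝ)
    (hΓ : ∀ i j k, Γ i j k = Γ j i k) (hdet : (Matrix.of (ricciSymbols Γ)).det ≠ 0) :
    (ofSymbols Γ hΓ).quasiEinstein 0 = Submodule.span ℝ {fun _ => (1 : ℝ)} := by
  apply le_antisymm
  · intro f hf
    have hp := fun i => partialD_eq_zero_of_det_ne_zero hf (by norm_num) hdet i 0
    have hmem := Submodule.add_mem _ hf (const_mem_quasiEinstein_zero Γ hΓ (-f 0))
    have hz := eq_zero_of_jet_eq_zero hmem (by simp) fun i => by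
      have := congrFun (partialD_add (hf.1.differentiable (by simp))
        (differentiable_const (-f 0)) i) 0
      rw [partialD_const, hp, add_zero] at this
      exact this
    rw [Submodule.mem_span_singleton]
    refine ⟨f 0, ?_⟩
    funext x
    have := congrFun hz x
    simp at this ⊢
    linarith
  · rw [Submodule.span_singleton_le_iff_mem]
    exact const_mem_quasiEinstein_zero Γ hΓ 1

/-! ### Ricci tensor of rank one -/

theorem sq_add_sq_ne_zero {v : Plane} (hv : v ≠ 0) : v 0 ^ 2 + v 1 ^ 2 ≠ 0 := by
  intro h
  apply hv
  ext k
  fin_cases k <;> simp <;> nlinarith [sq_nonneg (v 0), sq_nonneg (v 1)]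

/-- If `ρ = ε v ⊗ v` then `v`, as a constant one-form, satisfies `∇v = -c v ⊗ v`. -/
theorem exists_symbols_eq_of_ricci_rank_one {Γ : Fin 2 → Fin 2 → Fin 2 → ℝ}
    (hΓ : ∀ i j k, Γ i j k = Γ j i k) {ε : ℝ} {v : Plane} (hε : ε ≠ 0) (hv : v ≠ 0)
    (hρ : ∀ i j, ricciSymbols Γ i j = ε * (v i * v j)) :
    ∃ c : ℝ, ∀ i j, ∑ k, Γ i j k * v k = c * (v i * v j) := by
  have hN := sq_add_sq_ne_zero hv
  have cz : ∀ j, v 0 * (∑ k, Γ 1 j k * v k) = v 1 * (∑ k, Γ 0 j k * v k) := by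
    intro j
    have := ricciSymbols_codazzi Γ hΓ j
    simp only [hρ, Fin.sum_univ_two] at this ⊢
    apply mul_left_cancel₀ hε
    linear_combination this
  have hs : ∑ k, Γ 1 0 k * v k = ∑ k, Γ 0 1 k * v k := by simp only [hΓ 1 0]
  have c0 := cz 0
  have c1 := cz 1
  rw [hs] at c0
  -- The trace of `Γ_{ij}^k vₖ = c vᵢ vⱼ` forces this value of `c`.
  refine ⟨(∑ k, Γ 0 0 k * v k + ∑ k, Γ 1 1 k * v k) / (v 0 ^ 2 + v 1 ^ 2), fun i j => ?_⟩
  rw [div_mul_eq_mul_div, eq_div_iff hN]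
  fin_cases i <;> fin_cases j <;> simp only [Fin.zero_eta, Fin.mk_one, hs]
  · linear_combination -v 1 * c0 - v 0 * c1
  · linear_combination v 0 * c0 - v 1 * c1
  · linear_combination v 0 * c0 - v 1 * c1
  · linear_combination v 1 * c0 + v 0 * c1

/-- A nonzero symmetric bilinear form on the plane that is degenerate is `ε v ⊗ v`. -/
theorem exists_ricciSymbols_eq_of_det_eq_zero {Γ : Fin 2 → Fin 2 → Fin 2 → ℝ}
    (hΓ : ∀ i j k, Γ i j k = Γ j i k) (hdet : (Matrix.of (ricciSymbols Γ)).det = 0)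
    (hne : Matrix.of (ricciSymbols Γ) ≠ 0) :
    ∃ (ε : ℝ) (v : Plane), ε ≠ 0 ∧ v ≠ 0 ∧ ∀ i j, ricciSymbols Γ i j = ε * (v i * v j) := by
  have hs := ricciSymbols_comm Γ hΓ 1 0
  rw [Matrix.det_fin_two] at hdet
  simp only [Matrix.of_apply, hs] at hdet
  by_cases h : ricciSymbols Γ 0 0 = 0
  · have h01 : ricciSymbols Γ 0 1 = 0 := by
      rw [h] at hdet
      nlinarith
    have h11 : ricciSymbols Γ 1 1 ≠ 0 := by
      intro h11
      apply hne
      ext i j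
      fin_cases i <;> fin_cases j <;> simp [h, h01, h11, hs]
    refine ⟨ricciSymbols Γ 1 1, ![0, 1], h11, fun h => by simpa using congrFun h 1, ?_⟩
    intro i j
    fin_cases i <;> fin_cases j <;> simp [h, h01, hs]
  · refine ⟨(ricciSymbols Γ 0 0)⁻¹, ricciSymbols Γ 0, inv_ne_zero h,
      fun h' => h (by simpa using congrFun h' 0), ?_⟩
    intro i j
    fin_cases i <;> fin_cases j <;> simp [hs] <;> field_simp
    linear_combination hdet

theorem rank_quasiEinstein_of_ricci_rank_one (Γ : Fin 2 → Fin 2 → Fin 2 → ℝ)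
    (hΓ : ∀ i j k, Γ i j k = Γ j i k) {μ ε : ℝ} (hμ : μ ≠ -1) {v : Plane} (hε : ε ≠ 0)
    (hv : v ≠ 0) (hρ : ∀ i j, ricciSymbols Γ i j = ε * (v i * v j)) :
    Module.rank ℝ ((ofSymbols Γ hΓ).quasiEinstein μ) = 2 := by
  obtain ⟨c, hc⟩ := exists_symbols_eq_of_ricci_rank_one hΓ hε hv hρ
  have hN := sq_add_sq_ne_zero hv
  -- The value and the derivative along `v` at the origin.
  let φ : (Fin 3 → ℝ) →ₗ[ℝ] (Fin 2 → ℝ) :=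
    Matrix.toLin' !![1, 0, 0; 0, v 0, v 1]
  let ψ := φ ∘ₗ (ofSymbols Γ hΓ).jetMap μ
  have hψ0 : ∀ f, ψ f 0 = f.1 0 := by
    intro f
    simp [ψ, φ, jetMap, Matrix.mulVec, dotProduct, Fin.sum_univ_three]
  have hψ1 : ∀ f, ψ f 1 = v 0 * partialD 0 f.1 0 + v 1 * partialD 1 f.1 0 := by
    intro f
    simp [ψ, φ, jetMap, Matrix.mulVec, dotProduct, Fin.sum_univ_three]
  have hinj : Function.Injective ψ := by
    rw [injective_iff_map_eq_zero]
    intro f hf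
    have h0 := hψ0 f
    have h1 := hψ1 f
    rw [hf] at h0 h1
    have hpar : v 1 * partialD 0 f.1 0 = v 0 * partialD 1 f.1 0 := by
      obtain ⟨j, hj⟩ := Function.ne_iff.1 hv
      have := integrability f.2 hμ j 0
      rw [hρ, hρ] at this
      apply mul_left_cancel₀ (mul_ne_zero hε hj)
      linear_combination this
    refine Subtype.ext (eq_zero_of_jet_eq_zero f.2 h0.symm fun i => ?_)
    apply (mul_eq_zero.1 ?_).resolve_left hN
    simp only [Pi.zero_apply] at h1
    fin_cases i
    · simp only [Fin.zero_eta]; linear_combination v 1 * hpar - v 0 * h1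
    · simp only [Fin.mk_one]; linear_combination -v 0 * hpar - v 1 * h1
  have hsurj : Function.Surjective ψ := by
    intro w
    -- Solutions have the form `h (v·x)` with `h'' = c h' + μ ε h`; here `u = (h (v·x), h' (v·x))`.
    -- The derivative of `h (v·x)` along `v` is `|v|² h' (v·x)`, whence the initial value `w₁ / |v|²`.
    obtain ⟨u, hu, hu0, hd⟩ := exists_joint_flow (fun i => v i • !![0, 1; μ * ε, c])
      (((Commute.refl _).smul_left _).smul_right _) ![w 0, w 1 / (v 0 ^ 2 + v 1 ^ 2)]
    have hd0 : ∀ i, partialD i (u 0) = fun x => v i * u 1 x := by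
      intro i; funext x; rw [hd]; simp [Fin.sum_univ_two]
    have hd1 : ∀ i x, partialD i (u 1) x = v i * (μ * ε * u 0 x + c * u 1 x) := by
      intro i x; rw [hd]; simp [Fin.sum_univ_two]; ring
    have hmem : u 0 ∈ (ofSymbols Γ hΓ).quasiEinstein μ := by
      rw [mem_quasiEinstein_iff]
      refine ⟨hu 0, fun i j x => ?_⟩
      have := hc i j
      simp only [Fin.sum_univ_two] at this
      rw [Fin.sum_univ_two, hd0, hd0, hd0,
        partialD_const_mul ((hu 1).differentiable (by simp)), hρ]
      simp only [hd1]
      linear_combination -u 1 x * this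
    refine ⟨⟨u 0, hmem⟩, ?_⟩
    ext k
    fin_cases k
    · simp [hψ0, hu0]
    · simp only [Fin.mk_one, hψ1, hd0, hu0]
      simp
      field_simp
  rw [(LinearEquiv.ofBijective ψ ⟨hinj, hsurj⟩).rank_eq]
  simp

/-! ### Linear changes of coordinates -/

/-- The Christoffel symbols of the push-forward of `∇` by the linear map `T`: as a bilinear map,
`T Γ(T⁻¹ ·, T⁻¹ ·)`. -/
def pushSymbols (T : Plane ≃ₗ[ℝ] Plane) (Γ : Fin 2 → Fin 2 → Fin 2 → ℝ) (i j k : Fin 2) : ℝ :=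
  T (symbolMap Γ (T.symm (Pi.single i 1)) (T.symm (Pi.single j 1))) k

theorem symbolMap_comm {Γ : Fin 2 → Fin 2 → Fin 2 → ℝ} (hΓ : ∀ i j k, Γ i j k = Γ j i k)
    (a b : Plane) : symbolMap Γ a b = symbolMap Γ b a := by
  ext k
  simp only [symbolMap_apply, Fin.sum_univ_two, hΓ 1 0]
  ring

theorem pushSymbols_comm (T : Plane ≃ₗ[ℝ] Plane) {Γ : Fin 2 → Fin 2 → Fin 2 → ℝ}
    (hΓ : ∀ i j k, Γ i j k = Γ j i k) (i j k : Fin 2) :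
    pushSymbols T Γ i j k = pushSymbols T Γ j i k := by
  rw [pushSymbols, symbolMap_comm hΓ, pushSymbols]

theorem symbolMap_pushSymbols (T : Plane ≃ₗ[ℝ] Plane) (Γ : Fin 2 → Fin 2 → Fin 2 → ℝ)
    (a b : Plane) :
    symbolMap (pushSymbols T Γ) a b = T (symbolMap Γ (T.symm a) (T.symm b)) := by
  conv_rhs => rw [plane_eq_smul_single a, plane_eq_smul_single b]
  ext k
  simp only [symbolMap_apply (pushSymbols T Γ), pushSymbols, map_add, map_smul,
    LinearMap.add_apply, LinearMap.smul_apply, Fin.sum_univ_two, Pi.add_apply, Pi.smul_apply,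
    smul_eq_mul]
  ring

theorem linearlyEquivalent_push (T : Plane ≃ₗ[ℝ] Plane) (Γ : Fin 2 → Fin 2 → Fin 2 → ℝ)
    (hΓ : ∀ i j k, Γ i j k = Γ j i k) :
    (ofSymbols Γ hΓ).LinearlyEquivalent (ofSymbols (pushSymbols T Γ) (pushSymbols_comm T hΓ)) := by
  refine ⟨T, fun X Y _ hY => ?_⟩
  funext y
  let L := T.toContinuousLinearEquiv
  have hY' : HasFDerivAt (T ∘ Y ∘ T.symm)
      ((L : Plane →L[ℝ] Plane) ∘L fderiv ℝ Y (T.symm y) ∘L (L.symm : Plane →L[ℝ] Plane)) y :=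
    (L : Plane →L[ℝ] Plane).hasFDerivAt.comp y
      (((hY.differentiable (by simp)) _).hasFDerivAt.comp y L.symm.hasFDerivAt)
  rw [cov_ofSymbols _ _ _ _ _ hY'.differentiableAt, hY'.fderiv, symbolMap_pushSymbols]
  have hl : ∀ z, L z = T z := fun _ => rfl
  have hl' : ∀ z, L.symm z = T.symm z := fun _ => rfl
  simp [cov_ofSymbols _ _ _ _ _ (hY.differentiable (by simp) _), hl, hl']

theorem not_isFlat_push (T : Plane ≃ₗ[ℝ] Plane) (Γ : Fin 2 → Fin 2 → Fin 2 → ℝ)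
    (hΓ : ∀ i j k, Γ i j k = Γ j i k) (h : ¬ (ofSymbols Γ hΓ).IsFlat) :
    ¬ (ofSymbols (pushSymbols T Γ) (pushSymbols_comm T hΓ)).IsFlat := by
  rw [isFlat_ofSymbols_iff] at h ⊢
  intro h'
  refine h fun a b c => T.injective ?_
  simpa [symbolMap_pushSymbols] using h' (T a) (T b) (T c)

/-- Every nonzero linear form on the plane is the first coordinate of a linear isomorphism. -/
theorem exists_linearEquiv_first_coord {v : Plane} (hv : v ≠ 0) :
    ∃ T : Plane ≃ₗ[ℝ] Plane, ∀ a, T a 0 = v 0 * a 0 + v 1 * a 1 := by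
  let F : Plane →ₗ[ℝ] Plane := Matrix.toLin' !![v 0, v 1; -v 1, v 0]
  have hF : Function.Injective F := by
    rw [injective_iff_map_eq_zero]
    intro a ha
    have h0 := congrFun ha 0
    have h1 := congrFun ha 1
    simp [F, Matrix.mulVec, dotProduct, Fin.sum_univ_two] at h0 h1
    ext k
    apply (mul_eq_zero.1 ?_).resolve_left (sq_add_sq_ne_zero hv)
    fin_cases k
    · simp only [Fin.zero_eta]; linear_combination v 0 * h0 - v 1 * h1
    · simp only [Fin.mk_one]; linear_combination v 1 * h0 + v 0 * h1
  refine ⟨LinearEquiv.ofInjectiveEndo F hF, fun a => ?_⟩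
  simp [F, Matrix.mulVec, dotProduct, Fin.sum_univ_two]

/-! ### Solutions at `μ = 0` for a degenerate Ricci tensor -/

/-- If `x⁰` satisfies `Γ_{ij}^0 = a δᵢ⁰ δⱼ⁰` for a non-flat connection, then the solutions at `μ = 0`
depend on `x⁰` only, and are spanned by `1` and any solution `g` normalized by `∂₀g(0) = 1`. -/
theorem quasiEinstein_zero_eq_span_pair (Γ : Fin 2 → Fin 2 → Fin 2 → ℝ)
    (hΓ : ∀ i j k, Γ i j k = Γ j i k) (hflat : ¬ (ofSymbols Γ hΓ).IsFlat)
    (h01 : Γ 0 1 0 = 0) (h11 : Γ 1 1 0 = 0) {g : Plane → ℝ} (hg : ContDiff ℝ ∞ g)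
    (hg0 : partialD 0 (partialD 0 g) = fun x => Γ 0 0 0 * partialD 0 g x)
    (hg1 : partialD 1 g = fun _ => 0) (hgn : partialD 0 g 0 = 1) :
    (ofSymbols Γ hΓ).quasiEinstein 0 = Submodule.span ℝ {fun _ => (1 : ℝ), g} := by
  have h10 : Γ 1 0 0 = 0 := by rw [hΓ, h01]
  have hs : ∀ k, Γ 1 0 k = Γ 0 1 k := fun k => hΓ 1 0 k
  have hgm : g ∈ (ofSymbols Γ hΓ).quasiEinstein 0 := by
    rw [mem_quasiEinstein_iff]
    refine ⟨hg, fun i j x => ?_⟩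
    rw [Fin.sum_univ_two, hg1]
    fin_cases j
    · fin_cases i
      · simp [hg0]
      · simp [partialD_comm hg 1 0, hg1, partialD_const, h10]
    · fin_cases i <;> simp [hg1, partialD_const, h01, h11]
  have hρ1 : ∀ j, ricciSymbols Γ 1 j = 0 := by
    intro j
    fin_cases j <;> simp [ricciSymbols, Fin.sum_univ_two, h01, h11, hs]
  have hρ0 : ricciSymbols Γ 0 0 ≠ 0 := by
    intro h
    refine hflat (isFlat_of_ricciSymbols_eq_zero Γ hΓ fun i j => ?_)
    fin_cases i
    · fin_cases j
      · exact h
      · exact (ricciSymbols_comm Γ hΓ 0 1).trans (hρ1 0)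
    · exact hρ1 j
  apply le_antisymm
  · intro f hf
    have hf1 : partialD 1 f 0 = 0 := by
      have := integrability hf (by norm_num) 0 0
      rw [hρ1, zero_mul] at this
      exact (mul_eq_zero.1 this.symm).resolve_left hρ0
    set β := partialD 0 f 0 with hβ
    set α := f 0 - β * g 0 with hα
    have hm : (fun x => f x + ((-β) * g x + -α)) ∈ (ofSymbols Γ hΓ).quasiEinstein 0 :=
      Submodule.add_mem _ hf (Submodule.add_mem _ (Submodule.smul_mem _ (-β) hgm)
        (const_mem_quasiEinstein_zero Γ hΓ (-α)))
    have hgd : Differentiable ℝ g := hg.differentiable (by simp)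
    have hd : ∀ i, partialD i (fun x => f x + ((-β) * g x + -α))
        = fun x => partialD i f x + (-β) * partialD i g x := by
      intro i
      have hsum : Differentiable ℝ fun x => (-β) * g x + -α :=
        (hgd.const_mul _).add (differentiable_const _)
      rw [partialD_add (hf.1.differentiable (by simp)) hsum,
        partialD_add (hgd.const_mul _) (differentiable_const _), partialD_const_mul hgd,
        partialD_const]
      simp
    have hz := eq_zero_of_jet_eq_zero hm (by rw [hα]; ring) (fun i => by
      rw [hd]
      fin_cases i
      · simp [hgn, ← hβ]
      · simp [hf1, hg1])
    rw [Submodule.mem_span_pair]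
    refine ⟨α, β, ?_⟩
    funext x
    have := congrFun hz x
    simp only [Pi.zero_apply, Pi.add_apply, Pi.smul_apply, smul_eq_mul] at this ⊢
    linarith
  · rw [Submodule.span_le, Set.insert_subset_iff, Set.singleton_subset_iff]
    exact ⟨const_mem_quasiEinstein_zero Γ hΓ 1, hgm⟩

/-- A connection of degenerate nonzero Ricci tensor is linearly equivalent to a non-flat one with
`Γ_{01}^0 = Γ_{11}^0 = 0` and `Γ_{00}^0 ∈ {0, 1}`. -/
theorem exists_push_normal_form (Γ : Fin 2 → Fin 2 → Fin 2 → ℝ)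
    (hΓ : ∀ i j k, Γ i j k = Γ j i k) (hdet : (Matrix.of (ricciSymbols Γ)).det = 0)
    (hne : Matrix.of (ricciSymbols Γ) ≠ 0) :
    ∃ T : Plane ≃ₗ[ℝ] Plane, (pushSymbols T Γ 0 0 0 = 1 ∨ pushSymbols T Γ 0 0 0 = 0) ∧
      pushSymbols T Γ 0 1 0 = 0 ∧ pushSymbols T Γ 1 1 0 = 0 := by
  obtain ⟨ε, v, hε, hv, hρ⟩ := exists_ricciSymbols_eq_of_det_eq_zero hΓ hdet hne
  obtain ⟨c, hc⟩ := exists_symbols_eq_of_ricci_rank_one hΓ hε hv hρ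
  -- The new first coordinate is `s v·x`, where `s = c` normalizes `Γ_{00}^0` to one if `c ≠ 0`.
  obtain ⟨s, hs0, hs⟩ : ∃ s : ℝ, s ≠ 0 ∧ (c / s = 1 ∨ c / s = 0) := by
    by_cases h : c = 0
    · exact ⟨1, one_ne_zero, Or.inr (by simp [h])⟩
    · exact ⟨c, h, Or.inl (div_self h)⟩
  obtain ⟨T, hT⟩ := exists_linearEquiv_first_coord (smul_ne_zero hs0 hv)
  simp only [Pi.smul_apply, smul_eq_mul] at hT
  have key : ∀ i j, pushSymbols T Γ i j 0
      = c / s * ((Pi.single i 1 : Plane) 0 * (Pi.single j 1 : Plane) 0) := by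
    intro i j
    have hi := hT (T.symm (Pi.single i 1))
    have hj := hT (T.symm (Pi.single j 1))
    rw [T.apply_symm_apply] at hi hj
    rw [pushSymbols, hT, hi, hj]
    simp only [symbolMap_apply, Fin.sum_univ_two]
    have c00 := hc 0 0
    have c01 := hc 0 1
    have c10 := hc 1 0
    have c11 := hc 1 1
    simp only [Fin.sum_univ_two] at c00 c01 c10 c11
    generalize T.symm (Pi.single i 1) = a
    generalize T.symm (Pi.single j 1) = b
    field_simp
    linear_combination a 0 * b 0 * c00 + a 0 * b 1 * c01 + a 1 * b 0 * c10 + a 1 * b 1 * c11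
  exact ⟨T, by simpa [key] using hs, by simp [key], by simp [key]⟩

theorem partialD_exp_coord (i : Fin 2) :
    partialD i (fun x : Plane => Real.exp (x 0))
      = fun x => if i = 0 then Real.exp (x 0) else 0 := by
  funext x
  have : HasFDerivAt (fun x : Plane => Real.exp (x 0)) _ x :=
    (ContinuousLinearMap.proj 0 : Plane →L[ℝ] ℝ).hasFDerivAt.exp
  rw [partialD, this.fderiv]
  fin_cases i <;> simp

theorem partialD_coord (i : Fin 2) :
    partialD i (fun x : Plane => x 0) = fun _ => if i = 0 then 1 else 0 := by
  funext x
  have : HasFDerivAt (fun x : Plane => x 0) _ x :=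
    (ContinuousLinearMap.proj 0 : Plane →L[ℝ] ℝ).hasFDerivAt
  rw [partialD, this.fderiv]
  fin_cases i <;> simp

end AffineConnection
end

theorem theorem1p10 (D : AffineConnection) (hA : D.IsTypeA) (hD : ¬ D.IsFlat) :
    (D.quasiEinstein 0 = Submodule.span ℝ {fun _ => (1 : ℝ)} ∨
      (∃ D' : AffineConnection, D'.IsTypeA ∧ D.LinearlyEquivalent D' ∧
        (∀ x, D'.christoffel 0 0 0 x = 1) ∧ (∀ x, D'.christoffel 0 1 0 x = 0) ∧
        (∀ x, D'.christoffel 1 1 0 x = 0) ∧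
        D'.quasiEinstein 0 =
          Submodule.span ℝ {fun _ => (1 : ℝ), fun x : Plane => Real.exp (x 0)}) ∨
      (∃ D' : AffineConnection, D'.IsTypeA ∧ D.LinearlyEquivalent D' ∧
        (∀ x, D'.christoffel 0 0 0 x = 0) ∧ (∀ x, D'.christoffel 0 1 0 x = 0) ∧
        (∀ x, D'.christoffel 1 1 0 x = 0) ∧
        D'.quasiEinstein 0 =
          Submodule.span ℝ {fun _ => (1 : ℝ), fun x : Plane => x 0})) ∧
    Module.rank ℝ (D.quasiEinstein (-1)) = 3 ∧
    ∀ μ : ℝ, μ ≠ 0 → μ ≠ -1 →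
      ((∀ x, (D.ricci x).rank = 1) → Module.rank ℝ (D.quasiEinstein μ) = 2) ∧
      ((∀ x, (D.ricci x).rank = 2) → Module.rank ℝ (D.quasiEinstein μ) = 0) := by
  open AffineConnection in
  obtain ⟨Γ, hΓ, rfl⟩ := hA.exists_eq_ofSymbols
  have hne : Matrix.of (ricciSymbols Γ) ≠ 0 := fun h =>
    hD (isFlat_of_ricciSymbols_eq_zero Γ hΓ fun i j => congrFun (congrFun h i) j)
  refine ⟨?_, rank_quasiEinstein_neg_one Γ hΓ, fun μ hμ0 hμ => ⟨fun h => ?_, fun h => ?_⟩⟩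
  · by_cases hdet : (Matrix.of (ricciSymbols Γ)).det = 0
    · obtain ⟨T, h00, h01, h11⟩ := exists_push_normal_form Γ hΓ hdet hne
      have hflat := not_isFlat_push T Γ hΓ hD
      right
      refine h00.imp (fun h00 => ?_) (fun h00 => ?_)
      all_goals
        refine ⟨ofSymbols (pushSymbols T Γ) (pushSymbols_comm T hΓ), ⟨_, fun _ _ _ _ => rfl⟩,
          linearlyEquivalent_push T Γ hΓ, fun _ => h00, fun _ => h01, fun _ => h11, ?_⟩
      · exact quasiEinstein_zero_eq_span_pair _ _ hflat h01 h11
          (Real.contDiff_exp.comp (contDiff_apply ℝ ℝ 0))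
          (by simp [partialD_exp_coord, h00]) (by simp [partialD_exp_coord])
          (by simp [partialD_exp_coord])
      · exact quasiEinstein_zero_eq_span_pair _ _ hflat h01 h11 (contDiff_apply ℝ ℝ 0)
          (by simp [partialD_coord, partialD_const, h00]) (by simp [partialD_coord])
          (by simp [partialD_coord])
    · exact Or.inl (quasiEinstein_zero_of_det_ne_zero Γ hΓ hdet)
  · have h1 := h 0
    rw [ricci_ofSymbols] at h1
    have hdet : (Matrix.of (ricciSymbols Γ)).det = 0 := by
      by_contra hdet
      rw [Matrix.rank_of_det_ne_zero hdet] at h1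
      simp at h1
    obtain ⟨ε, v, hε, hv, hρ⟩ := exists_ricciSymbols_eq_of_det_eq_zero hΓ hdet hne
    exact rank_quasiEinstein_of_ricci_rank_one Γ hΓ hμ hε hv hρ
  · have h2 := h 0
    rw [ricci_ofSymbols] at h2
    have hdet : (Matrix.of (ricciSymbols Γ)).det ≠ 0 := by
      intro hdet
      obtain ⟨ε, v, -, -, hρ⟩ := exists_ricciSymbols_eq_of_det_eq_zero hΓ hdet hne
      have e : Matrix.of (ricciSymbols Γ) = Matrix.vecMulVec (ε • v) v := by
        ext i j
        simp [hρ, Matrix.vecMulVec_apply, mul_assoc]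
      have := Matrix.rank_vecMulVec_le (ε • v) v
      rw [← e, h2] at this
      omega
    rw [quasiEinstein_eq_bot_of_det_ne_zero Γ hΓ hμ0 hμ hdet]
    simp
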